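/- Let $S=\mathbb{C}[x_1,\dots,x_n]=\bigoplus_{i\ge 0}S_i$ with its standard grading. A property of tuples of forms of given degrees (or of a single form of given degree) holds for generic tuples (for a general form) if it holds on a nonempty Zariski open subset of the affine space of such tuples (forms). For $k,d\ge 1$, the generic $k$-rank $\mathrm{rk}^\circ_k(n,kd)$ is the smallest $s$ such that a general form of degree $kd$ in $n$ variables is a sum of $s$ $k$-th powers of forms of degree $d$. An ideal $I=(h_1,\dots,h_s)\subset S$ generated by forms of degrees $e_1,\dots,e_s$ is called Hilbert generic (with respect to these generators) if $$\sum_{i\ge 0}\dim_{\mathbb C}[S/I]_i\,t^i=\left\lceil\frac{\prod_{j=1}^s(1-t^{e_j})}{(1-t)^n}\right\rceil,$$ where $\lceil\cdot\rceil$ denotes truncation of a power series at its first non-positive coefficient (that coefficient and all later ones are replaced by $0$). Theorem. Let $k,d,n\ge 2$ be integers. Suppose that Nicklasson's conjecture holds for $(k,d,n)$, that is, for every $s\ge 1$ and generic forms $g_1,\dots,g_s$ of degree $d$ in $n$ variables, the ideal $(g_1^{k-1},\dots,g_s^{k-1})\subset S$ is Hilbert generic (its generators having degree $d(k-1)$).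 Then Ottaviani's conjecture holds for $(k,d,n)$, that is, $$\mathrm{rk}^\circ_k(n,kd)=\begin{cases}\min\left\{s\ge 1 \;\middle|\; s\binom{d+n-1}{n-1}-\binom{s}{2}\ge\binom{2d+n-1}{n-1}\right\}, & k=2,\\[4pt] \min\left\{s\ge 1 \;\middle|\; s\binom{d+n-1}{n-1}\ge\binom{kd+n-1}{n-1}\right\}, & k\ge 3.\end{cases}$$ In particular, if Nicklasson's conjecture holds for all $k,d,n\geq 2$, then so does Ottaviani's conjecture. -/

import Mathlib

namespace KRank

open MvPolynomial

/-- A property `P` of `s`-tuples of forms of degree `d` in `n` variables over `ℂ` holds for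
generic tuples: it holds on a nonempty Zariski open subset of the affine space of such tuples.
It is enough to consider open sets that are the complement of the zero set of one polynomial `Q` in
the coefficients of the forms, since these are a basis of the topology. The variable `(i, m)`
of `Q` stands for the coefficient of the monomial with exponent `m` in the `i`-th form. -/
def HoldsGenerically (n s d : ℕ) (P : (Fin s → MvPolynomial (Fin n) ℂ) → Prop) : Prop :=
  ∃ Q : MvPolynomial (Fin s × (Fin n →₀ ℕ)) ℂ,
    (∃ g : Fin s → MvPolynomial (Fin n) ℂ, (∀ i, (g i).IsHomogeneous d) ∧
      eval (fun p => coeff p.2 (g p.1)) Q ≠ 0) ∧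
    ∀ g : Fin s → MvPolynomial (Fin n) ℂ, (∀ i, (g i).IsHomogeneous d) →
      eval (fun p => coeff p.2 (g p.1)) Q ≠ 0 → P g

/-- `f` is a sum of `s` summands, each the `k`-th power of a form of degree `d`. -/
def IsSumOfPowers {n : ℕ} (k d s : ℕ) (f : MvPolynomial (Fin n) ℂ) : Prop :=
  ∃ g : Fin s → MvPolynomial (Fin n) ℂ, (∀ i, (g i).IsHomogeneous d) ∧ f = ∑ i, g i ^ k

/-- The generic `k`-rank of forms of degree `k * d` in `n` variables: the least `s` such that a
general form of degree `k * d` is a sum of `s` `k`-th powers of forms of degree `d`. -/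
noncomputable def genericRank (k d n : ℕ) : ℕ :=
  sInf {s : ℕ | HoldsGenerically n 1 (k * d) fun f => IsSumOfPowers k d s (f 0)}

/-- The Hilbert function of `S/I` in degree `i`: the dimension of the image of `S_i` in `S/I`. -/
noncomputable def hilbertFunction {n : ℕ} (I : Ideal (MvPolynomial (Fin n) ℂ)) (i : ℕ) : ℕ :=
  Module.finrank ℂ
    ((homogeneousSubmodule (Fin n) ℂ i).map (Ideal.Quotient.mkₐ ℂ I).toLinearMap)

/-- The Hilbert series of `S/I`. -/
noncomputable def hilbertSeries {n : ℕ} (I : Ideal (MvPolynomial (Fin n) ℂ)) : PowerSeries ℤ :=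
  PowerSeries.mk fun i => (hilbertFunction I i : ℤ)

open Classical in
/-- Truncation of a power series at its first non-positive coefficient (that coefficient and all
later ones are replaced by `0`). -/
noncomputable def truncation (F : PowerSeries ℤ) : PowerSeries ℤ :=
  PowerSeries.mk fun i => if ∀ j ≤ i, 0 < PowerSeries.coeff j F then PowerSeries.coeff i F else 0

/-- The power series `∏ i, (1 - t ^ e i) / (1 - t) ^ n`. -/
noncomputable def frobergSeries (n : ℕ) {s : ℕ} (e : Fin s → ℕ) : PowerSeries ℤ :=
  (∏ i, (1 - PowerSeries.X ^ e i)) * (PowerSeries.invOneSubPow ℤ n : PowerSeries ℤ)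

/-- The ideal generated by the forms `h i` of degrees `e i` is Hilbert generic. -/
def IsHilbertGeneric {n s : ℕ} (e : Fin s → ℕ) (h : Fin s → MvPolynomial (Fin n) ℂ) : Prop :=
  hilbertSeries (Ideal.span (Set.range h)) = truncation (frobergSeries n e)

/-- Nicklasson's conjecture for a given triple `(k, d, n)`: for every `s ≥ 1` the ideal generated
by the `(k - 1)`-th powers of `s` generic forms of degree `d` in `n` variables is Hilbert
generic. -/
def NicklassonConjecture (k d n : ℕ) : Prop :=
  ∀ s : ℕ, 1 ≤ s → HoldsGenerically n s d fun g =>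
    IsHilbertGeneric (fun _ => d * (k - 1)) fun i => g i ^ (k - 1)

/-- The condition on `s` in Ottaviani's formula; the subtraction is in `ℤ`. -/
def OttavianiInequality (k d n s : ℕ) : Prop :=
  if k = 2 then
    (s : ℤ) * ((d + n - 1).choose (n - 1) : ℕ) - (s.choose 2 : ℕ) ≥
      ((2 * d + n - 1).choose (n - 1) : ℕ)
  else
    s * (d + n - 1).choose (n - 1) ≥ (k * d + n - 1).choose (n - 1)

/-- Ottaviani's conjecture for a given triple `(k, d, n)`: the generic `k`-rank is the minimum of
the set of all `s ≥ 1` that satisfy the inequality. As `IsLeast` makes the generic `k`-rank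
positive, the set of which `genericRank` is the infimum is nonempty. -/
def OttavianiConjecture (k d n : ℕ) : Prop :=
  IsLeast {s : ℕ | 1 ≤ s ∧ OttavianiInequality k d n s} (genericRank k d n)

end KRank

namespace KRank

open MvPolynomial

/-! A general form of degree kd is a sum of s k-th powers exactly when the polynomial map (g_1, …,
g_s) ↦ ∑ g_i^k is dominant, that is, when its coordinates `powerSumCoeff` are algebraically
independent (`holdsGenerically_isSumOfPowers_iff`, by Chevalley and the Nullstellensatz).

Upper bound: the differential at g sends h to k ∑ g_i^(k-1) h_i, so it is onto when the ideal
(g_i^(k-1)) contains all forms of degree kd. Ottaviani's inequality says that the Fröberg series has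
a non-positive coefficient in degree kd (`coeff_frobergSeries_nonpos`), so Hilbert genericity forces
this. In characteristic 0 a differential that is onto at general points gives dominance
(`algebraicIndependent_powerSumCoeff`).

Lower bound: a dominant map needs a source at least as large as its target. For k = 2 the orthogonal
group O(s) acts on the fibres, which costs a further s(s-1)/2 dimensions. The algebraic form of this
is a bound on the transcendence degree of the entries of a Gram matrix
(`card_add_choose_le_of_gram`). -/

/-! ### Coordinates on tuples of forms -/

/-- The monomials of degree `d` in `n` variables. -/
abbrev Mon (n d : ℕ) : Type := {m : Fin n →₀ ℕ // m.degree = d}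

/-- Monomials of degree `d` correspond to the members of an antidiagonal. -/
def monEquiv (n d : ℕ) : Mon n d ≃ (Finset.univ : Finset (Fin n)).finsuppAntidiag d :=
  Equiv.subtypeEquivRight fun m => by
    simp [Finset.mem_finsuppAntidiag, Finsupp.degree_eq_sum]

noncomputable instance (n d : ℕ) : Fintype (Mon n d) := Fintype.ofEquiv _ (monEquiv n d).symm

theorem card_mon {n : ℕ} (hn : 1 ≤ n) (d : ℕ) :
    Fintype.card (Mon n d) = (d + n - 1).choose (n - 1) := by
  rw [Fintype.card_congr (monEquiv n d), Fintype.card_coe,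
    Finset.card_finsuppAntidiag_nat_eq_choose, Finset.card_univ, Fintype.card_fin,
    show n + d - 1 = d + n - 1 by omega, ← Nat.choose_symm (by omega)]
  congr 1
  omega

/-- The forms of degree `d` with given coefficients. -/
noncomputable def ofCoeffs {R : Type*} [CommRing R] {n s d : ℕ} (x : Fin s × Mon n d → R)
    (i : Fin s) : MvPolynomial (Fin n) R :=
  ∑ a : Mon n d, monomial a.1 (x (i, a))

section ofCoeffs

variable {R : Type*} [CommRing R] {n s d : ℕ}

theorem coeff_ofCoeffs (x : Fin s × Mon n d → R) (i : Fin s) (m : Fin n →₀ ℕ) :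
    coeff m (ofCoeffs x i) = if h : m.degree = d then x (i, ⟨m, h⟩) else 0 := by
  classical
  simp only [ofCoeffs, coeff_sum, coeff_monomial]
  split_ifs with h
  · rw [Finset.sum_eq_single ⟨m, h⟩]
    · simp
    · rintro b - hb
      rw [if_neg]
      rintro rfl
      exact hb rfl
    · simp
  · refine Finset.sum_eq_zero fun b _ => if_neg ?_
    rintro rfl
    exact h b.2

theorem isHomogeneous_ofCoeffs (x : Fin s × Mon n d → R) (i : Fin s) :
    (ofCoeffs x i).IsHomogeneous d :=
  IsHomogeneous.sum _ _ _ fun a _ => isHomogeneous_monomial _ a.2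

theorem ofCoeffs_coeff {g : Fin s → MvPolynomial (Fin n) R} (hg : ∀ i, (g i).IsHomogeneous d) :
    ofCoeffs (fun p : Fin s × Mon n d => coeff p.2.1 (g p.1)) = g := by
  funext i
  ext m
  rw [coeff_ofCoeffs]
  split_ifs with h
  · rfl
  · exact ((hg i).coeff_eq_zero h).symm

theorem map_ofCoeffs {R' : Type*} [CommRing R'] (f : R →+* R') (x : Fin s × Mon n d → R)
    (i : Fin s) : map f (ofCoeffs x i) = ofCoeffs (fun p => f (x p)) i := by
  simp [ofCoeffs, map_sum, map_monomial]

end ofCoeffs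

theorem eval_aeval_apply {σ τ : Type*} (x : σ → ℂ) (f : τ → MvPolynomial σ ℂ)
    (P : MvPolynomial τ ℂ) : eval x (aeval f P) = eval (fun m => eval x (f m)) P := by
  induction P using MvPolynomial.induction_on with
  | C a => simp
  | add p q hp hq => simp only [map_add, hp, hq]
  | mul_X p m hp => simp only [map_mul, hp, aeval_X, eval_X]

/-- A property holds generically iff it holds off the zero set of a nonzero polynomial in the
finitely many coefficients of the forms. -/
theorem holdsGenerically_iff {n s d : ℕ} {P : (Fin s → MvPolynomial (Fin n) ℂ) → Prop} :
    HoldsGenerically n s d P ↔ ∃ Q : MvPolynomial (Fin s × Mon n d) ℂ, Q ≠ 0 ∧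
      ∀ x, eval x Q ≠ 0 → P (ofCoeffs x) := by
  constructor
  · rintro ⟨Q, ⟨g, hg, hQ⟩, hP⟩
    have key : ∀ x : Fin s × Mon n d → ℂ, eval x (aeval (fun p : Fin s × (Fin n →₀ ℕ) =>
        if h : p.2.degree = d then (X (p.1, ⟨p.2, h⟩) : MvPolynomial (Fin s × Mon n d) ℂ) else 0) Q)
        = eval (fun p => coeff p.2 (ofCoeffs x p.1)) Q := by
      intro x
      rw [eval_aeval_apply]
      congr 2
      funext p
      rw [coeff_ofCoeffs]
      split_ifs <;> simp
    refine ⟨aeval (fun p : Fin s × (Fin n →₀ ℕ) =>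
      if h : p.2.degree = d then (X (p.1, ⟨p.2, h⟩) : MvPolynomial (Fin s × Mon n d) ℂ) else 0) Q,
      fun h0 => hQ ?_, fun x hx => hP _ (isHomogeneous_ofCoeffs x) ?_⟩
    · have := key (fun p : Fin s × Mon n d => coeff p.2.1 (g p.1))
      rw [h0, ofCoeffs_coeff hg, map_zero] at this
      exact this.symm
    · rw [← key]
      exact hx
  · rintro ⟨Q, hQ, hP⟩
    have key : ∀ g : Fin s → MvPolynomial (Fin n) ℂ, eval (fun p => coeff p.2 (g p.1))
        (rename (fun p : Fin s × Mon n d => (p.1, p.2.1)) Q)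
        = eval (fun p : Fin s × Mon n d => coeff p.2.1 (g p.1)) Q := by
      intro g
      rw [eval_rename]
      rfl
    refine ⟨rename (fun p : Fin s × Mon n d => (p.1, p.2.1)) Q, ?_, fun g hg hgQ => ?_⟩
    · obtain ⟨x, hx⟩ : ∃ x, eval x Q ≠ 0 := by
        by_contra! h
        exact hQ (MvPolynomial.funext fun x => by simp [h x])
      refine ⟨ofCoeffs x, isHomogeneous_ofCoeffs x, ?_⟩
      rw [key]
      convert hx using 3
      ext p
      simp [coeff_ofCoeffs, p.2.2]
    · rw [key] at hgQ
      rw [← ofCoeffs_coeff hg]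
      exact hP _ hgQ

/-! ### The power sum map and its differential -/

/-- The coefficients of the sum of the `k`-th powers of `s` forms of degree `d`, as polynomials in
the coefficients of these forms. -/
noncomputable def powerSumCoeff (n k d s : ℕ) (m : Mon n (k * d)) :
    MvPolynomial (Fin s × Mon n d) ℂ :=
  coeff m.1 (∑ i, ofCoeffs (X : Fin s × Mon n d → MvPolynomial (Fin s × Mon n d) ℂ) i ^ k)

theorem eval_powerSumCoeff {n k d s : ℕ} (x : Fin s × Mon n d → ℂ) (m : Mon n (k * d)) :
    eval x (powerSumCoeff n k d s m) = coeff m.1 (∑ i, ofCoeffs x i ^ k) := by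
  rw [powerSumCoeff, ← coeff_map]
  simp [map_ofCoeffs]

theorem eval_aeval_powerSumCoeff {n k d s : ℕ} (x : Fin s × Mon n d → ℂ)
    (P : MvPolynomial (Mon n (k * d)) ℂ) :
    eval x (aeval (powerSumCoeff n k d s) P) =
      eval (fun m => coeff m.1 (∑ i, ofCoeffs x i ^ k)) P := by
  rw [eval_aeval_apply]
  simp only [eval_powerSumCoeff]

section Derivative

variable {σ ι : Type*}

/-- The chain rule for a derivation applied to a polynomial expression. -/
theorem derivation_aeval {A : Type*} [CommRing A] [Algebra ℂ A] [Fintype ι]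
    (D : Derivation ℂ A A) (f : ι → A) (P : MvPolynomial ι ℂ) :
    D (aeval f P) = ∑ m, aeval f (pderiv m P) * D (f m) := by
  classical
  induction P using MvPolynomial.induction_on with
  | C a => simp [← algebraMap_eq]
  | add p q hp hq => simp [hp, hq, add_mul, Finset.sum_add_distrib]
  | mul_X p j hp =>
    have h1 : ∀ m, aeval f (pderiv m (X j : MvPolynomial ι ℂ)) = if m = j then 1 else 0 := by
      intro m
      rw [pderiv_X]
      split_ifs with h
      · simp [h]
      · simp [Pi.single_eq_of_ne (Ne.symm h)]
    simp only [map_mul, aeval_X, Derivation.leibniz, hp, map_add, smul_eq_mul, add_mul,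
      Finset.sum_add_distrib, h1, Finset.mul_sum]
    congr 1
    · simp
    · exact Finset.sum_congr rfl fun i _ => by ring

/-- Leibniz rule for a derivation of the coefficient ring: `f'` and `g'` arise from `f` and `g` by
applying `D` to each coefficient, the variables in `σ` being constants. -/
theorem derivation_coeff_mul {A : Type*} [CommRing A] [Algebra ℂ A] (D : Derivation ℂ A A)
    {f f' g g' : MvPolynomial σ A} (hf : ∀ m, D (coeff m f) = coeff m f')
    (hg : ∀ m, D (coeff m g) = coeff m g') (m : σ →₀ ℕ) :
    D (coeff m (f * g)) = coeff m (f * g' + g * f') := by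
  classical
  rw [mul_comm g f', coeff_add, coeff_mul, coeff_mul, coeff_mul, map_sum, ← Finset.sum_add_distrib]
  refine Finset.sum_congr rfl fun p _ => ?_
  simp only [Derivation.leibniz, hf, hg, smul_eq_mul]
  ring

theorem derivation_coeff_pow {A : Type*} [CommRing A] [Algebra ℂ A] (D : Derivation ℂ A A)
    {f f' : MvPolynomial σ A} (hf : ∀ m, D (coeff m f) = coeff m f') (k : ℕ) (m : σ →₀ ℕ) :
    D (coeff m (f ^ k)) = coeff m ((k : MvPolynomial σ A) * f ^ (k - 1) * f') := by
  induction k generalizing m with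
  | zero =>
    classical
    rw [pow_zero, coeff_one]
    split_ifs <;> simp
  | succ k ih =>
    rw [pow_succ, derivation_coeff_mul D ih hf]
    congr 1
    rcases k with _ | k
    · simp
    · simp only [Nat.add_sub_cancel]
      push_cast
      ring

/-- The derivative of the power sum map in the direction `h`. -/
theorem eval_mkDerivation_powerSumCoeff {n k d s : ℕ} (x h : Fin s × Mon n d → ℂ)
    (m : Mon n (k * d)) :
    eval x (mkDerivation ℂ (fun p => (C (h p) : MvPolynomial (Fin s × Mon n d) ℂ))
      (powerSumCoeff n k d s m)) =
      k * coeff m.1 (∑ i, ofCoeffs x i ^ (k - 1) * ofCoeffs h i) := by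
  have key := fun i => derivation_coeff_pow (mkDerivation ℂ
    (fun p => (C (h p) : MvPolynomial (Fin s × Mon n d) ℂ)))
    (f := ofCoeffs (X : Fin s × Mon n d → MvPolynomial (Fin s × Mon n d) ℂ) i)
    (f' := ofCoeffs (fun p => (C (h p) : MvPolynomial (Fin s × Mon n d) ℂ)) i)
    (fun m => by
      simp only [coeff_ofCoeffs]
      split_ifs
      · exact mkDerivation_X ..
      · simp) k m.1
  rw [powerSumCoeff, coeff_sum, map_sum, Finset.sum_congr rfl fun i _ => key i, ← coeff_sum,
    ← coeff_map]
  simp only [map_sum, map_mul, map_pow, map_natCast, map_ofCoeffs, eval_X, eval_C, coeff_sum,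
    Finset.mul_sum]
  refine Finset.sum_congr rfl fun i _ => ?_
  rw [mul_assoc, ← C_eq_coe_nat, coeff_C_mul]

theorem totalDegree_pderiv_le {P : MvPolynomial ι ℂ} {N : ℕ} (hP : P.totalDegree ≤ N + 1) (m : ι) :
    (pderiv m P).totalDegree ≤ N := by
  classical
  refine Finset.sup_le fun μ hμ => ?_
  rw [mem_support_iff, coeff_pderiv] at hμ
  have h1 := (le_totalDegree (mem_support_iff.mpr (left_ne_zero_of_mul hμ))).trans hP
  change (μ + Finsupp.single m 1).degree ≤ N + 1 at h1
  change μ.degree ≤ N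
  rw [map_add, Finsupp.degree_single] at h1
  omega

/-- Differentiating in a variable that occurs in a monomial multiplies its coefficient by the
exponent, which is nonzero in characteristic 0. -/
theorem eq_C_of_pderiv_eq_zero {P : MvPolynomial ι ℂ} (h : ∀ m, pderiv m P = 0) :
    P = C (coeff 0 P) := by
  classical
  ext μ
  rw [coeff_C]
  split_ifs with h0
  · rw [h0]
  · obtain ⟨m, hm⟩ : ∃ m, μ m ≠ 0 := by
      by_contra! h1
      exact h0 (Finsupp.ext fun m => (h1 m).symm)
    have h2 := congrArg (coeff (μ - Finsupp.single m 1)) (h m)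
    have h3 : μ - Finsupp.single m 1 + Finsupp.single m 1 = μ :=
      tsub_add_cancel_of_le (by simpa [Nat.one_le_iff_ne_zero] using hm)
    rw [coeff_pderiv, h3, coeff_zero] at h2
    exact (mul_eq_zero.mp h2).resolve_right (Nat.cast_add_one_ne_zero _)

end Derivative

/-! ### Dominance and generic sums of powers -/

/-- If the differential of the power sum map is surjective at the points of a nonempty Zariski open
set, then the power sum map is dominant. -/
theorem algebraicIndependent_powerSumCoeff {n k d s : ℕ} (hk : k ≠ 0)
    {Q : MvPolynomial (Fin s × Mon n d) ℂ} (hQ : Q ≠ 0)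
    (hsurj : ∀ x, eval x Q ≠ 0 → ∀ m : Mon n (k * d), ∃ h : Fin s × Mon n d → ℂ,
      ∑ i, ofCoeffs x i ^ (k - 1) * ofCoeffs h i = monomial m.1 1) :
    AlgebraicIndependent ℂ (powerSumCoeff n k d s) := by
  classical
  rw [algebraicIndependent_iff]
  intro P hP
  obtain ⟨N, hN⟩ : ∃ N, P.totalDegree ≤ N := ⟨_, le_rfl⟩
  have const : ∀ P : MvPolynomial (Mon n (k * d)) ℂ, P = C (coeff 0 P) →
      aeval (powerSumCoeff n k d s) P = 0 → P = 0 := by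
    intro P h1 h2
    rw [h1] at h2 ⊢
    simpa using h2
  induction N generalizing P with
  | zero => exact const P (totalDegree_eq_zero_iff_eq_C.mp (Nat.le_zero.mp hN)) hP
  | succ N ih =>
    refine const P (eq_C_of_pderiv_eq_zero fun m => ih _ ?_ (totalDegree_pderiv_le hN m)) hP
    -- Differentiate the relation `P` at `x` in a direction `h` whose image under the differential
    -- is k times the monomial `m`: only the partial derivative in `m` survives. So the partial
    -- derivatives of `P` are relations of lower degree.
    have : aeval (powerSumCoeff n k d s) (pderiv m P) * Q = 0 := by
      refine MvPolynomial.funext fun x => ?_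
      rw [map_mul, map_zero]
      by_cases hx : eval x Q = 0
      · rw [hx, mul_zero]
      obtain ⟨h, hh⟩ := hsurj x hx m
      have h1 := congrArg (eval x) (derivation_aeval (mkDerivation ℂ
        (fun p => (C (h p) : MvPolynomial (Fin s × Mon n d) ℂ))) (powerSumCoeff n k d s) P)
      rw [hP, map_zero, map_zero, map_sum] at h1
      simp only [map_mul, eval_mkDerivation_powerSumCoeff, hh, coeff_monomial] at h1
      rw [Finset.sum_eq_single m] at h1
      · have hk' : (k : ℂ) ≠ 0 := Nat.cast_ne_zero.mpr hk
        simp only [if_true, mul_one] at h1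
        rw [(mul_eq_zero.mp h1.symm).resolve_right hk', zero_mul]
      · intro b _ hb
        rw [if_neg fun h => hb (Subtype.ext h.symm)]
        simp
      · simp
    exact (mul_eq_zero.mp this).resolve_right hQ

/-- The image of a dominant polynomial map contains a nonempty Zariski open set. -/
theorem exists_ne_zero_forall_exists_eval_eq {σ τ : Type} [Finite σ] [Finite τ]
    {f : τ → MvPolynomial σ ℂ} (hf : AlgebraicIndependent ℂ f) :
    ∃ Q : MvPolynomial τ ℂ, Q ≠ 0 ∧
      ∀ y : τ → ℂ, eval y Q ≠ 0 → ∃ x : σ → ℂ, ∀ m, eval x (f m) = y m := by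
  classical
  let φ : MvPolynomial τ ℂ →+* MvPolynomial σ ℂ := (aeval f : _ →ₐ[ℂ] _).toRingHom
  have hinj : Function.Injective φ := hf
  have hfp : φ.FinitePresentation := by
    refine RingHom.FinitePresentation.of_finiteType.mp
      (RingHom.FiniteType.of_comp_finiteType (f := C) ?_)
    rw [show φ.comp C = algebraMap ℂ (MvPolynomial σ ℂ) from RingHom.ext fun a => by simp [φ]]
    exact RingHom.finiteType_algebraMap.mpr inferInstance
  obtain ⟨S, hS⟩ := PrimeSpectrum.exists_constructibleSetData_iff.mpr
    (PrimeSpectrum.isConstructible_range_comap hfp)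
  -- By Chevalley the image on spectra is constructible, and by injectivity it contains the generic
  -- point. The piece through that point has only zero equations, so it is the open set where `c.f`
  -- does not vanish.
  have hbot : (⟨⊥, Ideal.isPrime_bot⟩ : PrimeSpectrum (MvPolynomial τ ℂ)) ∈ S.toSet := by
    rw [hS]
    refine ⟨⟨⊥, Ideal.isPrime_bot⟩, PrimeSpectrum.ext ?_⟩
    exact (RingHom.injective_iff_ker_eq_bot φ).mp hinj
  simp only [PrimeSpectrum.ConstructibleSetData.toSet, Set.mem_iUnion] at hbot
  obtain ⟨c, hc, hcg, hcf⟩ := hbot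
  refine ⟨c.f, fun h0 => hcf (by simp [h0]), fun y hy => ?_⟩
  let M : Ideal (MvPolynomial τ ℂ) := RingHom.ker (eval y)
  have hM : M.IsMaximal := RingHom.ker_isMaximal_of_surjective _ fun a => ⟨C a, by simp⟩
  have hMS : (⟨M, hM.isPrime⟩ : PrimeSpectrum (MvPolynomial τ ℂ)) ∈ S.toSet := by
    simp only [PrimeSpectrum.ConstructibleSetData.toSet, Set.mem_iUnion]
    refine ⟨c, hc, ?_, ?_⟩
    · rintro _ ⟨i, rfl⟩
      have : c.g i = 0 := hcg ⟨i, rfl⟩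
      rw [this]
      exact M.zero_mem
    · intro h
      exact hy (h rfl)
  rw [hS] at hMS
  obtain ⟨p, hp⟩ := hMS
  have hp' : p.asIdeal.comap φ = M := congrArg PrimeSpectrum.asIdeal hp
  -- The prime over the point `y` need not be closed; a maximal ideal above it is a point `x` by the
  -- Nullstellensatz, still mapping to `y`.
  obtain ⟨N, hN, hpN⟩ := p.asIdeal.exists_le_maximal p.2.ne_top
  obtain ⟨x, rfl⟩ := isMaximal_iff_eq_vanishingIdeal_singleton.mp hN
  refine ⟨x, fun m => ?_⟩
  have h1 : X m - C (y m) ∈ M := by simp [M]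
  rw [← hp'] at h1
  have h2 := hpN h1
  simpa [φ, mem_vanishingIdeal_singleton_iff, sub_eq_zero] using h2

/-- If the power sum map is dominant, a general form is a sum of `s` powers, and conversely. -/
theorem holdsGenerically_isSumOfPowers_iff {n k d s : ℕ} :
    (HoldsGenerically n 1 (k * d) fun f => IsSumOfPowers k d s (f 0)) ↔
      AlgebraicIndependent ℂ (powerSumCoeff n k d s) := by
  have hhom : ∀ x : Fin s × Mon n d → ℂ, (∑ i, ofCoeffs x i ^ k).IsHomogeneous (k * d) :=
    fun x => IsHomogeneous.sum _ _ _ fun i _ =>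
      mul_comm d k ▸ (isHomogeneous_ofCoeffs x i).pow k
  rw [holdsGenerically_iff]
  constructor
  · rintro ⟨Q, hQ, hP⟩
    rw [algebraicIndependent_iff]
    intro P hPz
    -- A relation vanishes on the image of the map, which contains the set where `Q` is nonzero.
    have hmul : rename (fun m : Mon n (k * d) => ((0 : Fin 1), m)) P * Q = 0 := by
      refine MvPolynomial.funext fun y => ?_
      rw [map_mul, map_zero]
      by_cases hy : eval y Q = 0
      · rw [hy, mul_zero]
      obtain ⟨g, hg, hgy⟩ := hP y hy
      have h1 := eval_aeval_powerSumCoeff (k := k) (fun p : Fin s × Mon n d => coeff p.2.1 (g p.1)) P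
      rw [hPz, map_zero, ofCoeffs_coeff hg, ← hgy] at h1
      rw [eval_rename, show y ∘ (fun m : Mon n (k * d) => ((0 : Fin 1), m)) =
        fun m => coeff m.1 (ofCoeffs y 0) from _root_.funext fun m => by
          simp [coeff_ofCoeffs, m.2], ← h1, zero_mul]
    have := (mul_eq_zero.mp hmul).resolve_right hQ
    exact rename_injective _ (fun a b h => (Prod.ext_iff.mp h).2) (by simpa using this)
  · intro h
    obtain ⟨Q, hQ, hP⟩ := exists_ne_zero_forall_exists_eval_eq h
    refine ⟨rename (fun m : Mon n (k * d) => ((0 : Fin 1), m)) Q, ?_, fun y hy => ?_⟩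
    · intro h0
      exact hQ (rename_injective _ (fun a b h => (Prod.ext_iff.mp h).2) (by simpa using h0))
    · rw [eval_rename] at hy
      obtain ⟨x, hx⟩ := hP _ hy
      refine ⟨ofCoeffs x, isHomogeneous_ofCoeffs x, ?_⟩
      ext m
      rw [coeff_ofCoeffs]
      split_ifs with hm
      · rw [← eval_powerSumCoeff x ⟨m, hm⟩, hx]
        rfl
      · exact ((hhom x).coeff_eq_zero hm).symm

/-! ### Dimension counts and Gram matrices -/

/-- The number of algebraically independent elements of a finitely generated field extension is at
most the number of generators. -/
theorem card_le_card_of_algebraicIndependent {F L : Type} [Field F] [Field L] [Algebra F L]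
    {ι κ : Type} [Fintype ι] [Fintype κ] {v : ι → L} {t : κ → L} (hv : AlgebraicIndependent F v)
    (hvt : ∀ i, v i ∈ IntermediateField.adjoin F (Set.range t)) :
    Fintype.card ι ≤ Fintype.card κ := by
  have hind : (AlgebraicIndependent.matroid F L).Indep (Set.range v) :=
    AlgebraicIndependent.matroid_indep_iff.mpr hv.to_subtype_range
  have hsub : Set.range v ⊆ (AlgebraicIndependent.matroid F L).closure (Set.range t) := by
    rw [AlgebraicIndependent.matroid_closure_eq]
    rintro _ ⟨i, rfl⟩
    obtain ⟨a, ha, b, hb, hab⟩ := IntermediateField.mem_adjoin_iff_div.mp (hvt i)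
    have halg : ∀ c ∈ Algebra.adjoin F (Set.range t),
        IsAlgebraic (Algebra.adjoin F (Set.range t)) c := fun c hc =>
      isAlgebraic_algebraMap (⟨c, hc⟩ : Algebra.adjoin F (Set.range t))
    change IsAlgebraic (Algebra.adjoin F (Set.range t)) (v i)
    rw [hab, div_eq_mul_inv]
    exact (halg a ha).mul (halg b hb).inv
  have h1 := hind.encard_le_eRk_of_subset hsub
  rw [Matroid.eRk_closure_eq] at h1
  have h2 := h1.trans (Matroid.eRk_le_encard _ _)
  rw [← Set.image_univ, ← Set.image_univ, hv.injective.encard_image, Set.encard_univ] at h2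
  have h3 := h2.trans (Set.encard_image_le t Set.univ)
  rw [Set.encard_univ] at h3
  simpa using h3

open Matrix in
/-- The entries of the Gram matrix of the columns of a matrix with `s` rows lie in the field
generated by the rows of the Gram matrix that belong to `s` linearly independent columns. -/
theorem gram_mem_adjoin {F L : Type*} [Field F] [Field L] [Algebra F L] {ι : Type*} {s : ℕ}
    (A : Matrix (Fin s) ι L) (e : Fin s → ι) (hA : IsUnit (A.submatrix id e).det) (a b : ι) :
    (Aᵀ * A) a b ∈ IntermediateField.adjoin F
      (Set.range fun p : Fin s × ι => (Aᵀ * A) (e p.1) p.2) := by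
  set K := IntermediateField.adjoin F (Set.range fun p : Fin s × ι => (Aᵀ * A) (e p.1) p.2) with hK
  set A₁ := A.submatrix id e with hA₁
  have hmem : ∀ i c, (Aᵀ * A) (e i) c ∈ K := fun i c =>
    IntermediateField.subset_adjoin _ _ ⟨(i, c), rfl⟩
  let Q : Matrix (Fin s) ι K := fun i c => ⟨(Aᵀ * A) (e i) c, hmem i c⟩
  have hQ : Q.map (algebraMap K L) = A₁ᵀ * A := by
    ext i c
    rfl
  let P : Matrix (Fin s) (Fin s) K := Q.submatrix id e
  have hP : P.map (algebraMap K L) = A₁ᵀ * A₁ := by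
    ext i c
    rfl
  have hPdet : IsUnit P.det := by
    rw [isUnit_iff_ne_zero]
    intro h0
    have h1 := congrArg Matrix.det hP
    rw [← RingHom.mapMatrix_apply, ← RingHom.map_det, h0, map_zero, det_mul, det_transpose] at h1
    exact mul_ne_zero hA.ne_zero hA.ne_zero h1.symm
  have hinv : (P⁻¹).map (algebraMap K L) = A₁⁻¹ * A₁ᵀ⁻¹ := by
    rw [← Matrix.mul_inv_rev, ← hP]
    refine (inv_eq_right_inv ?_).symm
    rw [← Matrix.map_mul, mul_nonsing_inv _ hPdet, Matrix.map_one _ (map_zero _) (map_one _)]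
  -- With the block `A₁` invertible, AᵀA = (A₁ᵀA)ᵀ (A₁ᵀA₁)⁻¹ (A₁ᵀA), and all three factors have
  -- entries in `K`.
  have key : Aᵀ * A = (Qᵀ * P⁻¹ * Q).map (algebraMap K L) := by
    rw [Matrix.map_mul, Matrix.map_mul, transpose_map, hQ, hinv, transpose_mul,
      transpose_transpose]
    have h1 : A₁ * A₁⁻¹ = 1 := mul_nonsing_inv _ hA
    have h2 : A₁ᵀ⁻¹ * A₁ᵀ = 1 := nonsing_inv_mul _ (by rwa [det_transpose])
    calc Aᵀ * A = Aᵀ * ((A₁ * A₁⁻¹) * ((A₁ᵀ⁻¹ * A₁ᵀ) * A)) := by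
          rw [h1, h2, Matrix.one_mul, Matrix.one_mul]
      _ = Aᵀ * A₁ * (A₁⁻¹ * A₁ᵀ⁻¹) * (A₁ᵀ * A) := by simp only [Matrix.mul_assoc]
  rw [key]
  exact ((Qᵀ * P⁻¹ * Q) a b).2

/-- The field generated by the entries of the Gram matrix of the columns of a generic matrix with
`s` rows has transcendence degree at most the number of entries of the matrix minus
`s.choose 2`. -/
theorem card_add_choose_le_of_gram {F L ι κ : Type} [Field F] [Field L] [Algebra F L] [Fintype ι]
    [Fintype κ] {s : ℕ} (A : Matrix (Fin s) ι L) (e : Fin s ↪ ι)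
    (hA : IsUnit (A.submatrix id e).det) {v : κ → L} (hv : AlgebraicIndependent F v)
    (hmem : ∀ (K : IntermediateField F L), (∀ a b, (A.transpose * A) a b ∈ K) → ∀ m, v m ∈ K) :
    Fintype.card κ + s.choose 2 ≤ s * Fintype.card ι := by
  classical
  have hs : s ≤ Fintype.card ι := by simpa using Fintype.card_le_of_embedding e
  have hsymm : ∀ a b, (A.transpose * A) a b = (A.transpose * A) b a := fun a b => by
    rw [Matrix.mul_apply, Matrix.mul_apply]
    exact Finset.sum_congr rfl fun i _ => mul_comm _ _
  -- By symmetry of the Gram matrix, s(s+1)/2 + s(N-s) = sN - s(s-1)/2 generators suffice, where N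
  -- is the number of columns.
  let t : Sym2 (Fin s) ⊕ Fin s × {a // a ∉ Set.range e} → L :=
    Sum.elim (Sym2.lift ⟨fun i j => (A.transpose * A) (e i) (e j), fun i j => hsymm _ _⟩)
      fun p => (A.transpose * A) (e p.1) p.2
  have hrange : (Set.range fun p : Fin s × ι => (A.transpose * A) (e p.1) p.2) ⊆
      Set.range t := by
    rintro _ ⟨⟨i, a⟩, rfl⟩
    by_cases ha : a ∈ Set.range e
    · obtain ⟨j, rfl⟩ := ha
      exact ⟨Sum.inl s(i, j), rfl⟩
    · exact ⟨Sum.inr (i, ⟨a, ha⟩), rfl⟩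
  have hcard := card_le_card_of_algebraicIndependent hv (t := t) <| hmem _ fun a b =>
    IntermediateField.adjoin.mono _ _ _ hrange (gram_mem_adjoin A e hA a b)
  have hcompl : Fintype.card {a // a ∉ Set.range e} = Fintype.card ι - s := by
    rw [Fintype.card_subtype_compl]
    congr 1
    exact (Set.card_range_of_injective e.injective).trans (Fintype.card_fin s)
  rw [Fintype.card_sum, Sym2.card, Fintype.card_prod, Fintype.card_fin, hcompl,
    Nat.choose_succ_succ, Nat.choose_one_right] at hcard
  have h2 : s.choose 2 * 2 = s * (s - 1) := by
    rw [← Finset.sum_range_id_mul_two, Finset.sum_range_id, Nat.choose_two_right]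
  obtain ⟨c, hc⟩ := Nat.exists_eq_add_of_le hs
  rw [hc] at hcard ⊢
  rw [Nat.add_sub_cancel_left] at hcard
  rcases s with _ | s
  · simpa using hcard
  · rw [Nat.add_sub_cancel] at h2
    nlinarith

/-- Exhibits each coefficient of a sum of squares as a sum of Gram entries of the `s`-rowed matrix
of variables. -/
theorem powerSumCoeff_two (n d s : ℕ) (m : Mon n (2 * d)) :
    powerSumCoeff n 2 d s m = ∑ a : Mon n d, ∑ b : Mon n d,
      if a.1 + b.1 = m.1 then ∑ i : Fin s, X (i, a) * X (i, b) else 0 := by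
  have h1 : powerSumCoeff n 2 d s m = ∑ i : Fin s, ∑ a : Mon n d, ∑ b : Mon n d,
      if a.1 + b.1 = m.1 then X (i, a) * X (i, b) else 0 := by
    classical
    rw [powerSumCoeff, coeff_sum]
    refine Finset.sum_congr rfl fun i _ => ?_
    simp only [ofCoeffs, sq, Finset.sum_mul_sum, monomial_mul, coeff_sum, coeff_monomial]
  rw [h1, Finset.sum_comm]
  refine Finset.sum_congr rfl fun a _ => ?_
  rw [Finset.sum_comm]
  refine Finset.sum_congr rfl fun b _ => ?_
  split_ifs
  · rfl
  · exact Finset.sum_const_zero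

/-- A square matrix of distinct variables is invertible. -/
theorem det_of_X_ne_zero {ι : Type} {s : ℕ} (e : Fin s ↪ ι) :
    (Matrix.of fun i j => (X (i, e j) : MvPolynomial (Fin s × ι) ℂ)).det ≠ 0 := by
  classical
  intro h0
  have h1 := congrArg (eval fun p : Fin s × ι => if p.2 = e p.1 then (1 : ℂ) else 0) h0
  rw [RingHom.map_det, map_zero] at h1
  have h2 : (eval fun p : Fin s × ι => if p.2 = e p.1 then (1 : ℂ) else 0).mapMatrix
      (Matrix.of fun i j => (X (i, e j) : MvPolynomial (Fin s × ι) ℂ)) = 1 := by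
    ext i j
    simp [Matrix.one_apply, eq_comm]
  rw [h2, Matrix.det_one] at h1
  exact one_ne_zero h1

/-- For sums of squares, the power sum map has fibres of dimension at least `s.choose 2`. -/
theorem card_add_choose_le_of_algebraicIndependent {n d s : ℕ}
    (hs : s ≤ Fintype.card (Mon n d)) (h : AlgebraicIndependent ℂ (powerSumCoeff n 2 d s)) :
    Fintype.card (Mon n (2 * d)) + s.choose 2 ≤ s * Fintype.card (Mon n d) := by
  obtain ⟨e⟩ : Nonempty (Fin s ↪ Mon n d) :=
    Function.Embedding.nonempty_of_card_le (by simpa using hs)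
  let φ := IsScalarTower.toAlgHom ℂ (MvPolynomial (Fin s × Mon n d) ℂ)
    (FractionRing (MvPolynomial (Fin s × Mon n d) ℂ))
  have hφ : Function.Injective φ := IsFractionRing.injective _ _
  refine card_add_choose_le_of_gram (Matrix.of fun i a => φ (X (i, a))) e ?_ (h.map' hφ) ?_
  · rw [isUnit_iff_ne_zero]
    have h1 := (map_ne_zero_iff φ.toRingHom hφ).mpr (det_of_X_ne_zero e)
    rw [RingHom.map_det] at h1
    exact h1
  · intro K hK m
    rw [Function.comp_apply, powerSumCoeff_two, map_sum]
    refine sum_mem fun a _ => ?_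
    rw [map_sum]
    refine sum_mem fun b _ => ?_
    split_ifs
    · have := hK a b
      rw [Matrix.mul_apply] at this
      simp only [map_sum, map_mul]
      exact this
    · rw [map_zero]
      exact zero_mem _

/-- The dimension of the source of a dominant map is at least the dimension of its target. -/
theorem card_le_of_algebraicIndependent {n k d s : ℕ}
    (h : AlgebraicIndependent ℂ (powerSumCoeff n k d s)) :
    Fintype.card (Mon n (k * d)) ≤ s * Fintype.card (Mon n d) := by
  have h1 := h.cardinalMk_le_trdeg
  rw [MvPolynomial.trdeg_of_isDomain, Cardinal.lift_id, Cardinal.mk_fintype, Cardinal.mk_fintype,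
    Nat.cast_le, Fintype.card_prod, Fintype.card_fin] at h1
  exact h1

/-- Every monomial of degree `2 * d` is a product of two monomials of degree `d`. -/
theorem card_mon_two_mul_le (n d : ℕ) :
    Fintype.card (Mon n (2 * d)) ≤ (Fintype.card (Mon n d) + 1).choose 2 := by
  rw [← Sym2.card]
  refine Fintype.card_le_of_surjective (Sym2.lift ⟨fun a b => ⟨a.1 + b.1, by
    rw [map_add, a.2, b.2, two_mul]⟩, fun a b => Subtype.ext (add_comm _ _)⟩) fun m => ?_
  obtain ⟨a, ham, had⟩ := m.1.exists_le_degree_eq d (by rw [m.2]; omega)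
  obtain ⟨b, hb⟩ := exists_add_of_le ham
  have hbd : b.degree = d := by
    have := m.2
    rw [hb, map_add, had] at this
    omega
  exact ⟨s(⟨a, had⟩, ⟨b, hbd⟩), Subtype.ext hb.symm⟩

/-! ### The Fröberg series in degree kd, and the upper bound -/

theorem one_sub_pow_eq {R : Type*} [CommRing R] (y : R) (s : ℕ) :
    ∃ r, (1 - y) ^ s = 1 - s * y + s.choose 2 * y ^ 2 + y ^ 3 * r := by
  induction s with
  | zero => exact ⟨0, by simp⟩
  | succ s ih =>
    obtain ⟨r, hr⟩ := ih
    refine ⟨r * (1 - y) - s.choose 2, ?_⟩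
    rw [pow_succ, hr, Nat.choose_succ_succ, Nat.choose_one_right]
    push_cast
    ring

/-- Terms of order three and more start in degree 3d(k-1) > kd. The quadratic term starts in degree
2d(k-1), which exceeds kd unless k = 2; there it contributes s(s-1)/2, whence the two cases of the
formula. -/
theorem coeff_frobergSeries_nonpos {k d n s : ℕ} (hk : 2 ≤ k) (hd : 1 ≤ d) (hn : 1 ≤ n)
    (h : OttavianiInequality k d n s) :
    PowerSeries.coeff (k * d) (frobergSeries n fun _ : Fin s => d * (k - 1)) ≤ 0 := by
  obtain ⟨r, hr⟩ := one_sub_pow_eq ((PowerSeries.X : PowerSeries ℤ) ^ (d * (k - 1))) s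
  obtain ⟨k, rfl⟩ := Nat.exists_eq_add_of_le' hk
  obtain ⟨n, rfl⟩ := Nat.exists_eq_add_of_le' hn
  rw [frobergSeries, Finset.prod_const, Finset.card_univ, Fintype.card_fin, hr,
    PowerSeries.invOneSubPow_val_succ_eq_mk_add_choose, ← pow_mul, ← pow_mul]
  simp only [add_mul, sub_mul, one_mul, map_add, map_sub, mul_assoc]
  rw [← map_natCast (PowerSeries.C (R := ℤ)), ← map_natCast (PowerSeries.C (R := ℤ)),
    PowerSeries.coeff_C_mul, PowerSeries.coeff_C_mul, PowerSeries.coeff_X_pow_mul',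
    PowerSeries.coeff_X_pow_mul', PowerSeries.coeff_X_pow_mul']
  simp only [PowerSeries.coeff_mk]
  have e1 : d * (k + 2 - 1) = k * d + d := by
    rw [show k + 2 - 1 = k + 1 by omega]
    ring
  have e2 : (k + 2) * d = k * d + 2 * d := by ring
  have h3 : ¬ 3 * (k * d + d) ≤ k * d + 2 * d := by omega
  rw [show d * ((k + 2 - 1) * 3) = 3 * (k * d + d) by rw [← e1]; ring,
    show d * ((k + 2 - 1) * 2) = 2 * (k * d + d) by rw [← e1]; ring, e1,
    if_pos (by omega), if_neg h3, show k * d + 2 * d - (k * d + d) = d by omega]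
  rw [OttavianiInequality] at h
  split_ifs at h with h2
  · obtain rfl : k = 0 := by omega
    simp only [← add_assoc, Nat.add_sub_cancel, add_comm _ n] at h
    simp only [zero_mul, zero_add, le_refl, if_true, Nat.sub_self, add_zero, Nat.choose_self]
    push_cast
    linarith
  · have hkd : 0 < k * d := Nat.mul_pos (by omega) hd
    rw [if_neg (by omega)]
    simp only [← add_assoc, Nat.add_sub_cancel, add_comm _ n, e2] at h
    rw [← add_assoc]
    zify at h
    linarith

/-- If the ideal generated by the `(k - 1)`-th powers of forms of degree `d` contains all forms of
degree `k * d`, then these are combinations of the powers with coefficients of degree `d`. -/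
theorem exists_sum_mul_eq_of_hilbertFunction_eq_zero {n k d s : ℕ} (hk : 1 ≤ k)
    (x : Fin s × Mon n d → ℂ)
    (h : hilbertFunction (Ideal.span (Set.range fun i => ofCoeffs x i ^ (k - 1))) (k * d) = 0)
    (m : Mon n (k * d)) :
    ∃ y : Fin s × Mon n d → ℂ,
      ∑ i, ofCoeffs x i ^ (k - 1) * ofCoeffs y i = monomial m.1 1 := by
  classical
  -- `finrank` is also 0 on infinite-dimensional spaces, so finiteness is needed to conclude that
  -- the image vanishes.
  have hfin : Module.Finite ℂ (homogeneousSubmodule (Fin n) ℂ (k * d)) :=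
    Module.Finite.iff_fg.mpr (homogeneousSubmodule_fg _ _ _)
  rw [hilbertFunction, Submodule.finrank_eq_zero] at h
  have hm : (monomial m.1 (1 : ℂ)) ∈ homogeneousSubmodule (Fin n) ℂ (k * d) :=
    isHomogeneous_monomial _ m.2
  have h1 := Submodule.mem_map_of_mem (f := (Ideal.Quotient.mkₐ ℂ
    (Ideal.span (Set.range fun i => ofCoeffs x i ^ (k - 1)))).toLinearMap) hm
  rw [h, Submodule.mem_bot] at h1
  have h2 := Ideal.Quotient.eq_zero_iff_mem.mp h1
  obtain ⟨c, hc⟩ := Ideal.mem_span_range_iff_exists_fun.mp h2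
  -- In degree kd = d + d(k-1) only the degree `d` parts of the cofactors matter.
  refine ⟨fun p => coeff p.2.1 (homogeneousComponent d (c p.1)), ?_⟩
  have h3 := congrArg (homogeneousComponent (k * d)) hc
  rw [homogeneousComponent_of_mem hm, if_pos rfl, map_sum] at h3
  rw [ofCoeffs_coeff fun i => homogeneousComponent_isHomogeneous d (c i), ← h3]
  refine Finset.sum_congr rfl fun i _ => ?_
  have h4 : ofCoeffs x i ^ (k - 1) ∈ homogeneousSubmodule (Fin n) ℂ (d * (k - 1)) :=
    (isHomogeneous_ofCoeffs x i).pow _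
  let := MvPolynomial.gradedAlgebra (σ := Fin n) (R := ℂ)
  have h5 := DirectSum.coe_decompose_mul_add_of_right_mem
    (homogeneousSubmodule (Fin n) ℂ) (i := d) (a := c i) h4
  have h6 : d + d * (k - 1) = k * d := by
    obtain ⟨k, rfl⟩ := Nat.exists_eq_add_of_le' hk
    rw [Nat.add_sub_cancel]
    ring
  rw [h6] at h5
  have h7 : ∀ φ j, (DirectSum.decompose (homogeneousSubmodule (Fin n) ℂ) φ j : MvPolynomial _ ℂ) =
      homogeneousComponent j φ := fun φ j => decomposition.decompose'_apply φ j
  rw [h7, h7] at h5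
  rw [mul_comm, h5]

theorem algebraicIndependent_of_nicklassonConjecture {k d n s : ℕ} (hk : 2 ≤ k) (hd : 1 ≤ d)
    (hn : 1 ≤ n) (hN : NicklassonConjecture k d n) (hs : 1 ≤ s)
    (h : OttavianiInequality k d n s) : AlgebraicIndependent ℂ (powerSumCoeff n k d s) := by
  obtain ⟨Q, hQ, hP⟩ := holdsGenerically_iff.mp (hN s hs)
  refine algebraicIndependent_powerSumCoeff (by omega) hQ fun x hx m =>
    exists_sum_mul_eq_of_hilbertFunction_eq_zero (by omega) x ?_ m
  have h1 := congrArg (PowerSeries.coeff (k * d)) (hP x hx)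
  simp only [hilbertSeries, truncation, PowerSeries.coeff_mk] at h1
  rw [if_neg fun h2 => (h2 _ le_rfl).not_ge (coeff_frobergSeries_nonpos hk hd hn h)] at h1
  exact_mod_cast h1

/-! ### The numerical minimum -/

/-- For k = 2 take s = N = dim S_d: then sN - s(s-1)/2 = N(N+1)/2, which bounds dim S_2d. The bound
s ≤ N is recorded because the Gram argument needs s independent columns. -/
theorem exists_ottavianiInequality {k d n : ℕ} (hn : 1 ≤ n) :
    ∃ s, 1 ≤ s ∧ OttavianiInequality k d n s ∧ (k = 2 → s ≤ Fintype.card (Mon n d)) := by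
  have hpos : 1 ≤ (d + n - 1).choose (n - 1) := Nat.choose_pos (by omega)
  by_cases hk : k = 2
  · have h1 := card_mon_two_mul_le n d
    rw [card_mon hn, card_mon hn, Nat.choose_succ_succ, Nat.choose_one_right] at h1
    refine ⟨(d + n - 1).choose (n - 1), hpos, ?_, fun _ => (card_mon hn d).ge⟩
    rw [OttavianiInequality, if_pos hk]
    set N := (d + n - 1).choose (n - 1)
    have h2 : N.choose 2 * 2 = N * (N - 1) := by
      rw [← Finset.sum_range_id_mul_two, Finset.sum_range_id, Nat.choose_two_right]
    obtain ⟨M, hM⟩ := Nat.exists_eq_add_of_le' hpos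
    rw [hM] at h1 h2 ⊢
    rw [Nat.add_sub_cancel] at h2
    zify at h1 h2
    push_cast
    nlinarith
  · refine ⟨(k * d + n - 1).choose (n - 1), Nat.choose_pos (by omega), ?_, fun h => absurd h hk⟩
    rw [OttavianiInequality, if_neg hk]
    exact Nat.le_mul_of_pos_right _ hpos

theorem ottavianiInequality_of_algebraicIndependent {k d n s : ℕ} (hn : 1 ≤ n)
    (hs : k = 2 → s ≤ Fintype.card (Mon n d))
    (h : AlgebraicIndependent ℂ (powerSumCoeff n k d s)) : OttavianiInequality k d n s := by
  rw [OttavianiInequality]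
  split_ifs with hk
  · subst hk
    have h1 := card_add_choose_le_of_algebraicIndependent (hs rfl) h
    rw [card_mon hn, card_mon hn] at h1
    zify at h1
    linarith
  · have h1 := card_le_of_algebraicIndependent h
    rwa [card_mon hn, card_mon hn] at h1

theorem not_ottavianiInequality_zero {k d n : ℕ} (hn : 1 ≤ n) : ¬ OttavianiInequality k d n 0 := by
  have h1 : 0 < (k * d + n - 1).choose (n - 1) := Nat.choose_pos (by omega)
  rw [OttavianiInequality]
  split_ifs with hk
  · subst hk
    simp
    omega
  · simp
    omega

end KRank

theorem theoremA (k d n : ℕ) (hk : 2 ≤ k) (hd : 2 ≤ d) (hn : 2 ≤ n)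
    (hN : KRank.NicklassonConjecture k d n) : KRank.OttavianiConjecture k d n := by
  open KRank in
  classical
  have hn1 : 1 ≤ n := by omega
  obtain ⟨s, hs1, hs, hsle⟩ := exists_ottavianiInequality (k := k) (d := d) hn1
  have hdom : ∀ r, 1 ≤ r → OttavianiInequality k d n r →
      HoldsGenerically n 1 (k * d) fun f => IsSumOfPowers k d r (f 0) := fun r hr h =>
    holdsGenerically_isSumOfPowers_iff.mpr
      (algebraicIndependent_of_nicklassonConjecture hk (by omega) hn1 hN hr h)
  have hle : ∀ r, 1 ≤ r → OttavianiInequality k d n r → genericRank k d n ≤ r :=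
    fun r hr h => Nat.sInf_le (hdom r hr h)
  -- The set is nonempty, so its infimum is attained and is not the default value 0.
  have hrank := holdsGenerically_isSumOfPowers_iff.mp
    (Nat.sInf_mem (s := {s | HoldsGenerically n 1 (k * d) fun f => IsSumOfPowers k d s (f 0)})
      ⟨s, hdom s hs1 hs⟩)
  -- The upper bound already puts the rank at most dim S_d when k = 2, as the lower bound requires.
  have hineq : OttavianiInequality k d n (genericRank k d n) :=
    ottavianiInequality_of_algebraicIndependent hn1
      (fun h => (hle s hs1 hs).trans (hsle h)) hrank
  refine ⟨⟨Nat.one_le_iff_ne_zero.mpr fun h0 => ?_, hineq⟩, fun r hr => hle r hr.1 hr.2⟩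
  rw [h0] at hineq
  exact not_ottavianiInequality_zero hn1 hineq
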